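/- Let $R$ be an associative ring with identity, let $n$ be a non-negative integer or $\infty$ (with $\infty+1=\infty$), and let modules be left $R$-modules. Let $\mathcal{P}^{<n+1}$ be the class of modules $M$ admitting an exact sequence $0\to P_k\to\cdots\to P_1\to P_0\to M\to 0$ with $k$ a non-negative integer, $k\le n$, and every $P_i$ finitely generated projective. A short exact sequence $0\to A\to B\to C\to 0$ is called $n$-exact if $0\to \mathrm{Hom}_R(M,A)\to \mathrm{Hom}_R(M,B)\to \mathrm{Hom}_R(M,C)\to 0$ is exact for every $M\in\mathcal{P}^{<n+1}$, and a module $P$ is called $n$-projective if $\mathrm{Hom}_R(P,-)$ keeps every $n$-exact sequence exact; $\mathcal{P}_n$ denotes the class of $n$-projective modules. A complex $X^\bullet$ is called $n$-exact at $i$ if $0\to \mathrm{Ker}(d^i)\to X^i\to \mathrm{Coker}(d^{i-1})\to 0$ is an $n$-exact sequence, and $n$-exact if it is $n$-exact at every $i\in\mathbb{Z}$. Let $K(R)$ be the homotopy category of cochain complexes of $R$-modules and $K^b(R)$ its full subcategory of bounded complexes. Let $K^b_n(R)\subseteq K^b(R)$ be the thick subcategory of $n$-exact bounded complexes, and let $D^b_n(R):=K^b(R)/K^b_n(R)$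 be the Verdier quotient (the bounded $n$-derived category). Let $K^{-,nb}(\mathcal{P}_n)\subseteq K(R)$ be the full triangulated subcategory of those bounded above complexes $X^\bullet$ with all terms in $\mathcal{P}_n$ for which there is $m\in\mathbb{Z}$ such that $X^\bullet$ is $n$-exact at every $i\le m$. **Theorem.** There is an equivalence of triangulated categories $$D^b_n(R)\;\cong\; K^{-,nb}(\mathcal{P}_n).$$ -/

import Mathlib

open CategoryTheory Limits Opposite ZeroObject

universe u

namespace NDerived

/-! ### Modules with finite projective resolutions, `n`-exact sequences, `n`-projective modules -/

/-- `M` has a resolution `0 → P_k → ⋯ → P_1 → P_0 → M → 0` of length at most `k`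
by finitely generated projective left `R`-modules. -/
def HasFiniteProjRes (R : Type u) [Ring R] (k : ℕ) (M : ModuleCat.{u} R) : Prop :=
  ∃ P : ProjectiveResolution M,
    (∀ i, Module.Finite R (P.complex.X i)) ∧ ∀ i, k < i → IsZero (P.complex.X i)

/-- The class `𝒫^{<n+1}`, for `n` a natural number or `∞` (with `∞ + 1 = ∞`): the modules that
have a finite resolution, of length at most `n`, by finitely generated projective modules. -/
def finProjRes (R : Type u) [Ring R] (n : ℕ∞) : ObjectProperty (ModuleCat.{u} R) :=
  fun M => ∃ k : ℕ, (k : ℕ∞) ≤ n ∧ HasFiniteProjRes R k M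

/-- The sequence `0 → Hom(M, S.X₁) → Hom(M, S.X₂) → Hom(M, S.X₃) → 0` is exact. -/
def HomShortExact {R : Type u} [Ring R] (M : ModuleCat.{u} R)
    (S : ShortComplex (ModuleCat.{u} R)) : Prop :=
  (S.map (preadditiveCoyoneda.obj (op M))).ShortExact

/-- `n`-exact short exact sequences. -/
def IsNExact {R : Type u} [Ring R] (n : ℕ∞) (S : ShortComplex (ModuleCat.{u} R)) : Prop :=
  S.ShortExact ∧ ∀ M, finProjRes R n M → HomShortExact M S

/-- The class `𝒫_n` of `n`-projective modules. -/
def nProj (R : Type u) [Ring R] (n : ℕ∞) : ObjectProperty (ModuleCat.{u} R) :=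
  fun M => ∀ S : ShortComplex (ModuleCat.{u} R), IsNExact n S → HomShortExact M S

/-! ### `n`-exact complexes -/

/-- The complex `X` is `n`-exact at `i`: the sequence
`0 → Ker (dⁱ) → Xⁱ → Coker (dⁱ⁻¹) → 0` is an `n`-exact short exact sequence. -/
def NExactAt {R : Type u} [Ring R] (n : ℕ∞) (X : CochainComplex (ModuleCat.{u} R) ℤ)
    (i : ℤ) : Prop :=
  ∃ w : X.iCycles i ≫ X.pOpcycles i = 0, IsNExact n (ShortComplex.mk _ _ w)

/-- The homotopy category `K(R)` of cochain complexes of left `R`-modules. -/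
abbrev K (R : Type u) [Ring R] := HomotopyCategory (ModuleCat.{u} R) (ComplexShape.up ℤ)

/-- Objects of `K(R)` that are `n`-exact complexes. -/
def nExact (R : Type u) [Ring R] (n : ℕ∞) : ObjectProperty (K R) :=
  fun X => ∀ i, NExactAt n X.as i

/-- Objects of `K(R)` that are `n`-exact in all sufficiently low degrees. -/
def nExactLow (R : Type u) [Ring R] (n : ℕ∞) : ObjectProperty (K R) :=
  fun X => ∃ m : ℤ, ∀ i ≤ m, NExactAt n X.as i

/-- Bounded complexes. -/
def bounded (R : Type u) [Ring R] : ObjectProperty (K R) :=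
  fun X => (∃ a : ℤ, ∀ i < a, IsZero (X.as.X i)) ∧ ∃ b : ℤ, ∀ i > b, IsZero (X.as.X i)

/-- Bounded above complexes with `n`-projective terms. -/
def minusNProj (R : Type u) [Ring R] (n : ℕ∞) : ObjectProperty (K R) :=
  fun X => (∃ b : ℤ, ∀ i > b, IsZero (X.as.X i)) ∧ ∀ i, nProj R n (X.as.X i)

/-! ### Exactness of `Hom(P, X)`, used to see that the subcategories above are triangulated -/

section Aux

variable {R : Type u} [Ring R]

lemma homShortExact_iff (M : ModuleCat.{u} R) (S : ShortComplex (ModuleCat.{u} R))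
    (hS : S.ShortExact) :
    HomShortExact M S ↔ ∀ f : M ⟶ S.X₃, ∃ g : M ⟶ S.X₂, g ≫ S.g = f := by
  have := hS.mono_f
  constructor
  · intro h f
    have := h.epi_g
    exact (AddCommGrpCat.epi_iff_surjective _).1 this f
  · intro h
    have h1 : Mono (S.map (preadditiveCoyoneda.obj (op M))).f := by
      rw [AddCommGrpCat.mono_iff_injective]
      intro (a : M ⟶ S.X₁) (b : M ⟶ S.X₁) (hab : a ≫ S.f = b ≫ S.f)
      exact (cancel_mono S.f).1 hab
    have h2 : Epi (S.map (preadditiveCoyoneda.obj (op M))).g := by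
      rw [AddCommGrpCat.epi_iff_surjective]
      exact h
    refine ShortComplex.ShortExact.mk ?_
    rw [ShortComplex.ab_exact_iff]
    intro (f : M ⟶ S.X₂) (hf : f ≫ S.g = 0)
    exact ⟨hS.exact.lift f hf, hS.exact.lift_f f hf⟩

lemma nProj_iff (n : ℕ∞) (M : ModuleCat.{u} R) :
    nProj R n M ↔ ∀ S : ShortComplex (ModuleCat.{u} R), IsNExact n S →
      ∀ f : M ⟶ S.X₃, ∃ g : M ⟶ S.X₂, g ≫ S.g = f :=
  forall_congr' fun S => forall_congr' fun hS => homShortExact_iff M S hS.1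

lemma nProj_of_isZero (n : ℕ∞) {M : ModuleCat.{u} R} (h : IsZero M) : nProj R n M := by
  rw [nProj_iff]
  exact fun S _ f => ⟨0, h.eq_of_src _ _⟩

instance (n : ℕ∞) : (nProj R n).IsClosedUnderIsomorphisms where
  of_iso e h := by
    rw [nProj_iff] at h ⊢
    intro S hS f
    obtain ⟨g, hg⟩ := h S hS (e.hom ≫ f)
    exact ⟨e.inv ≫ g, by simp [hg]⟩

lemma nProj_biprod (n : ℕ∞) {M N : ModuleCat.{u} R} (hM : nProj R n M) (hN : nProj R n N) :
    nProj R n (M ⊞ N) := by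
  rw [nProj_iff] at hM hN ⊢
  intro S hS f
  obtain ⟨g, hg⟩ := hM S hS (biprod.inl ≫ f)
  obtain ⟨g', hg'⟩ := hN S hS (biprod.inr ≫ f)
  exact ⟨biprod.desc g g', biprod.hom_ext' _ _ (by simp [hg]) (by simp [hg'])⟩

/-- The complex `Hom(P, X)` is exact in degree `i`. -/
def HomExactAt (P : ModuleCat.{u} R) (X : CochainComplex (ModuleCat.{u} R) ℤ) (i : ℤ) : Prop :=
  ∀ f : P ⟶ X.X i, f ≫ X.d i (i + 1) = 0 → ∃ g : P ⟶ X.X (i - 1), g ≫ X.d (i - 1) i = f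

lemma homExactAt_iff' (P : ModuleCat.{u} R) (X : CochainComplex (ModuleCat.{u} R) ℤ)
    (i j k : ℤ) (hi : i + 1 = j) (hk : j + 1 = k) :
    HomExactAt P X j ↔ ∀ f : P ⟶ X.X j, f ≫ X.d j k = 0 → ∃ g : P ⟶ X.X i, g ≫ X.d i j = f := by
  obtain rfl : i = j - 1 := by lia
  subst hk
  rfl

lemma homExactAt_iff_isZero (P : ModuleCat.{u} R) (X : K R) (i : ℤ) :
    HomExactAt P X.as i ↔
      IsZero (((preadditiveCoyoneda.obj (op P)).mapHomotopyCategory (ComplexShape.up ℤ) ⋙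
        HomotopyCategory.homologyFunctor _ _ i).obj X) := by
  let Y := ((preadditiveCoyoneda.obj (op P)).mapHomologicalComplex (ComplexShape.up ℤ)).obj X.as
  have h1 : IsZero (((preadditiveCoyoneda.obj (op P)).mapHomotopyCategory (ComplexShape.up ℤ) ⋙
        HomotopyCategory.homologyFunctor _ _ i).obj X) ↔ Y.ExactAt i := by
    rw [HomologicalComplex.exactAt_iff_isZero_homology]
    exact ((HomotopyCategory.homologyFunctorFactors _ (ComplexShape.up ℤ) i).app Y).isZero_iff
  rw [h1, Y.exactAt_iff' (i - 1) i (i + 1) (by simp) (by simp), ShortComplex.ab_exact_iff]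
  rfl

lemma homExactAt_shift (P : ModuleCat.{u} R) (X : CochainComplex (ModuleCat.{u} R) ℤ)
    (a i : ℤ) (h : HomExactAt P X (i + a)) : HomExactAt P (X⟦a⟧) i := by
  rw [homExactAt_iff' P X (i - 1 + a) (i + a) (i + 1 + a) (by lia) (by lia)] at h
  intro (f : P ⟶ X.X (i + a)) hf
  have hf' : f ≫ X.d (i + a) (i + 1 + a) = 0 := by
    have : f ≫ (a.negOnePow • X.d (i + a) (i + 1 + a)) = 0 := hf
    rwa [Linear.comp_units_smul, smul_eq_zero_iff_eq] at this
  obtain ⟨g, hg⟩ := h f hf'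
  refine ⟨a.negOnePow • g, ?_⟩
  change (a.negOnePow • g) ≫ (a.negOnePow • X.d (i - 1 + a) (i + a)) = f
  rw [Linear.comp_units_smul, Linear.units_smul_comp, smul_smul, Int.units_mul_self, one_smul]
  exact hg

lemma finProjRes_self (n : ℕ∞) : finProjRes R n (ModuleCat.of R R) := by
  refine ⟨0, by simp, ProjectiveResolution.self (ModuleCat.of R R), fun i => ?_, fun i hi => ?_⟩
  · cases i with
    | zero =>
      exact Module.Finite.equiv
        (HomologicalComplex.singleObjXSelf (ComplexShape.down ℕ) 0 (ModuleCat.of R R)).symm.toLinearEquiv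
    | succ i =>
      have := ModuleCat.subsingleton_of_isZero (HomologicalComplex.isZero_single_obj_X
        (ComplexShape.down ℕ) 0 (ModuleCat.of R R) (i + 1) (by simp))
      exact Module.Finite.of_finite (R := R)
        (M := ((ChainComplex.single₀ (ModuleCat.{u} R)).obj (ModuleCat.of R R)).X (i + 1))
  · exact HomologicalComplex.isZero_single_obj_X _ _ _ _ (by lia)

lemma exactAt_of_homExactAt (X : CochainComplex (ModuleCat.{u} R) ℤ) (i : ℤ)
    (h : HomExactAt (ModuleCat.of R R) X i) : X.ExactAt i := by
  rw [X.exactAt_iff' (i - 1) i (i + 1) (by simp) (by simp), ShortComplex.moduleCat_exact_iff]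
  intro (x : X.X i) (hx : X.d i (i + 1) x = 0)
  obtain ⟨g, hg⟩ := h (ModuleCat.ofHom (LinearMap.toSpanSingleton R _ x)) (by
    ext
    simpa using hx)
  refine ⟨g (1 : R), ?_⟩
  change (g ≫ X.d (i - 1) i) (1 : R) = x
  rw [hg]
  simp

lemma mono_fromOpcycles_of_isZero (X : CochainComplex (ModuleCat.{u} R) ℤ) (i j : ℤ)
    (hij : i + 1 = j) (h : IsZero (X.homology i)) : Mono (X.fromOpcycles i j) :=
  Preadditive.mono_of_cancel_zero _ fun k hk => by
    obtain ⟨l, hl⟩ := KernelFork.IsLimit.lift' (X.homologyIsKernel i j (by simp [hij])) k hk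
    rw [← hl, h.eq_of_tgt l 0, zero_comp]

lemma epi_toCycles_of_isZero (X : CochainComplex (ModuleCat.{u} R) ℤ) (i j : ℤ)
    (hij : i + 1 = j) (h : IsZero (X.homology j)) : Epi (X.toCycles i j) :=
  Preadditive.epi_of_cancel_zero _ fun k hk => by
    obtain ⟨l, hl⟩ := CokernelCofork.IsColimit.desc' (X.homologyIsCokernel i j (by simp [← hij])) k hk
    rw [← hl, h.eq_of_src l 0, comp_zero]

lemma isZero_homology_of_comp_eq_zero (X : CochainComplex (ModuleCat.{u} R) ℤ) (i : ℤ)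
    (w : X.iCycles i ≫ X.pOpcycles i = 0) : IsZero (X.homology i) := by
  rw [IsZero.iff_id_eq_zero, ← cancel_epi (X.homologyπ i), ← cancel_mono (X.homologyι i)]
  simp [w]

lemma nExactAt_of_homExactAt (n : ℕ∞) (X : CochainComplex (ModuleCat.{u} R) ℤ) (i j : ℤ)
    (hij : i + 1 = j) (h : ∀ P, finProjRes R n P → HomExactAt P X i)
    (h' : ∀ P, finProjRes R n P → HomExactAt P X j) : NExactAt n X i := by
  have hX := exactAt_of_homExactAt X i (h _ (finProjRes_self n))
  rw [HomologicalComplex.exactAt_iff_isZero_homology] at hX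
  have e1 : Epi (X.toCycles (i - 1) i) := epi_toCycles_of_isZero X _ _ (by lia) hX
  have e2 : Mono (X.fromOpcycles i j) := mono_fromOpcycles_of_isZero X _ _ hij hX
  have w : X.iCycles i ≫ X.pOpcycles i = 0 := by
    rw [← cancel_epi (X.toCycles (i - 1) i)]
    simp
  have hS : (ShortComplex.mk _ _ w).ShortExact := by
    have : Mono (ShortComplex.mk _ _ w).f := inferInstanceAs (Mono (X.iCycles i))
    have : Epi (ShortComplex.mk _ _ w).g := inferInstanceAs (Epi (X.pOpcycles i))
    refine ShortComplex.ShortExact.mk (ShortComplex.exact_of_f_is_kernel _ ?_)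
    refine KernelFork.IsLimit.ofι' _ _ fun {A} (k : A ⟶ X.X i) (hk : k ≫ X.pOpcycles i = 0) =>
      ⟨X.liftCycles k j (by simp [hij]) ?_, X.liftCycles_i _ _ _ _⟩
    rw [← X.p_fromOpcycles i j, reassoc_of% hk, zero_comp]
  refine ⟨w, hS, fun P hP => (homShortExact_iff P _ hS).2 fun (f : P ⟶ X.opcycles i) => ?_⟩
  have hP' := (homExactAt_iff' P X i j (j + 1) hij rfl).1 (h' P hP)
  obtain ⟨g, hg⟩ := hP' (f ≫ X.fromOpcycles i j) (by simp)
  refine ⟨g, ?_⟩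
  rw [← cancel_mono (X.fromOpcycles i j)]
  simpa using hg

lemma homExactAt_of_nExactAt (n : ℕ∞) (X : CochainComplex (ModuleCat.{u} R) ℤ) (i j : ℤ)
    (hij : i + 1 = j) (h : NExactAt n X i) (h' : NExactAt n X j)
    (P : ModuleCat.{u} R) (hP : finProjRes R n P) : HomExactAt P X j := by
  obtain ⟨w, hS, hw⟩ := h
  obtain ⟨w', hS', -⟩ := h'
  have e1 : Mono (X.opcyclesToCycles i j) := by
    have := mono_fromOpcycles_of_isZero X i j hij (isZero_homology_of_comp_eq_zero X i w)
    rw [← X.opcyclesToCycles_iCycles i j] at this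
    exact mono_of_mono _ (X.iCycles j)
  have e2 : Epi (X.opcyclesToCycles i j) := by
    have := epi_toCycles_of_isZero X i j hij (isZero_homology_of_comp_eq_zero X j w')
    rw [← X.pOpcycles_opcyclesToCycles i j] at this
    exact epi_of_epi (X.pOpcycles i) _
  have e : IsIso (X.opcyclesToCycles i j) := isIso_of_mono_of_epi _
  rw [homExactAt_iff' P X i j (j + 1) hij rfl]
  intro f hf
  obtain ⟨g, hg : g ≫ X.pOpcycles i = _⟩ := (homShortExact_iff P _ hS).1 (hw P hP)
    (X.liftCycles f (j + 1) (by simp) hf ≫ inv (X.opcyclesToCycles i j))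
  refine ⟨g, ?_⟩
  rw [← X.pOpcycles_opcyclesToCycles_iCycles i j, reassoc_of% hg, IsIso.inv_hom_id_assoc,
    X.liftCycles_i]

lemma nExact_iff (n : ℕ∞) (X : K R) :
    nExact R n X ↔ ∀ i, ∀ P, finProjRes R n P → HomExactAt P X.as i :=
  ⟨fun h i P hP => homExactAt_of_nExactAt n X.as (i - 1) i (by lia) (h _) (h _) P hP,
    fun h i => nExactAt_of_homExactAt n X.as i (i + 1) rfl (h i) (h (i + 1))⟩

lemma nExactLow_iff (n : ℕ∞) (X : K R) :
    nExactLow R n X ↔ ∃ m : ℤ, ∀ i ≤ m, ∀ P, finProjRes R n P → HomExactAt P X.as i :=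
  ⟨fun ⟨m, h⟩ => ⟨m, fun i hi P hP =>
      homExactAt_of_nExactAt n X.as (i - 1) i (by lia) (h _ (by lia)) (h _ hi) P hP⟩,
    fun ⟨m, h⟩ => ⟨m - 1, fun i hi =>
      nExactAt_of_homExactAt n X.as i (i + 1) rfl (h i (by lia)) (h (i + 1) (by lia))⟩⟩

lemma homExactAt_of_iso {X Y : K R} (e : X ≅ Y) (P : ModuleCat.{u} R) (i : ℤ)
    (h : HomExactAt P X.as i) : HomExactAt P Y.as i := by
  rw [homExactAt_iff_isZero] at h ⊢
  exact h.of_iso (Functor.mapIso _ e.symm)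

lemma homExactAt_of_isZero {X : K R} (hX : IsZero X) (P : ModuleCat.{u} R) (i : ℤ) :
    HomExactAt P X.as i := by
  rw [homExactAt_iff_isZero]
  exact Functor.map_isZero _ hX

lemma homExactAt_ext₂ (T : Pretriangulated.Triangle (K R))
    (hT : T ∈ Pretriangulated.distinguishedTriangles) (P : ModuleCat.{u} R) (i : ℤ)
    (h₁ : HomExactAt P T.obj₁.as i) (h₃ : HomExactAt P T.obj₃.as i) :
    HomExactAt P T.obj₂.as i := by
  rw [homExactAt_iff_isZero] at h₁ h₃ ⊢
  exact (Functor.map_distinguished_exact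
    ((preadditiveCoyoneda.obj (op P)).mapHomotopyCategory (ComplexShape.up ℤ) ⋙
      HomotopyCategory.homologyFunctor _ _ i) T hT).isZero_of_both_zeros
    (h₁.eq_of_src _ _) (h₃.eq_of_tgt _ _)

/-- To be closed under extensions it suffices to be closed under mapping cones. -/
lemma isTriangulatedClosed₃_of_cone (Q : ObjectProperty (K R))
    (h : ∀ (X Y : K R) (f : X.as ⟶ Y.as), Q X → Q Y →
      Q ((HomotopyCategory.quotient _ _).obj (CochainComplex.mappingCone f))) :
    Q.IsTriangulatedClosed₃ where
  ext₃' T hT h₁ h₂ := by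
    obtain ⟨f : T.obj₁.as ⟶ T.obj₂.as, hf⟩ :=
      (HomotopyCategory.quotient _ _).map_surjective T.mor₁
    refine ⟨_, h _ _ f h₁ h₂,
      ⟨Pretriangulated.Triangle.π₃.mapIso (Pretriangulated.isoTriangleOfIso₁₂ T _ hT
        (HomotopyCategory.mappingCone_triangleh_distinguished f)
        (Iso.refl _) (Iso.refl _) ?_)⟩⟩
    change T.mor₁ ≫ 𝟙 _ = 𝟙 _ ≫ (HomotopyCategory.quotient _ _).map f
    rw [Category.comp_id, Category.id_comp, hf]

lemma shift_as (X : K R) (a : ℤ) : (X⟦a⟧).as = X.as⟦a⟧ := by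
  obtain ⟨Y, rfl⟩ := HomotopyCategory.quotient_obj_surjective X
  rw [HomotopyCategory.shift_quotient_obj]
  rfl

end Aux

/-! ### The triangulated subcategories -/

section Triangulated

variable (R : Type u) [Ring R] (n : ℕ∞)

instance : (nExact R n).IsClosedUnderIsomorphisms where
  of_iso e h := by
    rw [nExact_iff] at h ⊢
    exact fun i P hP => homExactAt_of_iso e P i (h i P hP)

instance : (nExactLow R n).IsClosedUnderIsomorphisms where
  of_iso e h := by
    rw [nExactLow_iff] at h ⊢
    obtain ⟨m, h⟩ := h
    exact ⟨m, fun i hi P hP => homExactAt_of_iso e P i (h i hi P hP)⟩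

instance : (nExact R n).IsTriangulated where
  exists_zero := ⟨0, isZero_zero _, by
    rw [nExact_iff]
    exact fun i P _ => homExactAt_of_isZero (isZero_zero _) P i⟩
  isStableUnderShiftBy a := ⟨fun X h => by
    change nExact R n (X⟦a⟧)
    rw [nExact_iff] at h ⊢
    rw [shift_as]
    exact fun i P hP => homExactAt_shift P X.as a i (h _ P hP)⟩
  toIsTriangulatedClosed₂ := .mk' fun T hT h₁ h₃ => by
    rw [nExact_iff] at h₁ h₃ ⊢
    exact fun i P hP => homExactAt_ext₂ T hT P i (h₁ i P hP) (h₃ i P hP)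

instance : (nExactLow R n).IsTriangulated where
  exists_zero := ⟨0, isZero_zero _, by
    rw [nExactLow_iff]
    exact ⟨0, fun i _ P _ => homExactAt_of_isZero (isZero_zero _) P i⟩⟩
  isStableUnderShiftBy a := ⟨fun X h => by
    change nExactLow R n (X⟦a⟧)
    rw [nExactLow_iff] at h ⊢
    obtain ⟨m, h⟩ := h
    rw [shift_as]
    exact ⟨m - a, fun i hi P hP => homExactAt_shift P X.as a i (h _ (by lia) P hP)⟩⟩
  toIsTriangulatedClosed₂ := .mk' fun T hT h₁ h₃ => by
    rw [nExactLow_iff] at h₁ h₃ ⊢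
    obtain ⟨m₁, h₁⟩ := h₁
    obtain ⟨m₃, h₃⟩ := h₃
    exact ⟨min m₁ m₃, fun i hi P hP =>
      homExactAt_ext₂ T hT P i (h₁ i (by lia) P hP) (h₃ i (by lia) P hP)⟩

instance : (bounded R).ContainsZero where
  exists_zero := ⟨(HomotopyCategory.quotient _ _).obj (0 : CochainComplex (ModuleCat.{u} R) ℤ),
    Functor.map_isZero _ (isZero_zero _),
    ⟨0, fun i _ => Functor.map_isZero (HomologicalComplex.eval _ _ i) (isZero_zero _)⟩,
    ⟨0, fun i _ => Functor.map_isZero (HomologicalComplex.eval _ _ i) (isZero_zero _)⟩⟩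

instance : (bounded R).IsStableUnderShift ℤ where
  isStableUnderShiftBy k := ⟨fun X ⟨⟨a, ha⟩, ⟨b, hb⟩⟩ => by
    change bounded R (X⟦k⟧)
    rw [bounded, shift_as]
    exact ⟨⟨a - k, fun i hi => ha (i + k) (by lia)⟩, ⟨b - k, fun i hi => hb (i + k) (by lia)⟩⟩⟩

instance : (bounded R).IsTriangulated where
  toIsTriangulatedClosed₂ := by
    have : (bounded R).IsTriangulatedClosed₃ := isTriangulatedClosed₃_of_cone _ (by
      intro X Y f ⟨⟨a, ha⟩, ⟨b, hb⟩⟩ ⟨⟨a', ha'⟩, ⟨b', hb'⟩⟩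
      refine ⟨⟨min (a - 1) a', fun i hi => ?_⟩, ⟨max b b', fun i hi => ?_⟩⟩
      · exact (CochainComplex.mappingCone.isZero_X_iff f i).2
          ⟨ha _ (by lia), ha' _ (by lia)⟩
      · exact (CochainComplex.mappingCone.isZero_X_iff f i).2
          ⟨hb _ (by lia), hb' _ (by lia)⟩)
    exact .of_isTriangulatedClosed₃

instance : (minusNProj R n).ContainsZero where
  exists_zero := ⟨(HomotopyCategory.quotient _ _).obj (0 : CochainComplex (ModuleCat.{u} R) ℤ),
    Functor.map_isZero _ (isZero_zero _),
    ⟨0, fun i _ => Functor.map_isZero (HomologicalComplex.eval _ _ i) (isZero_zero _)⟩,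
    fun i => nProj_of_isZero n (Functor.map_isZero (HomologicalComplex.eval _ _ i) (isZero_zero _))⟩

instance : (minusNProj R n).IsStableUnderShift ℤ where
  isStableUnderShiftBy k := ⟨fun X ⟨⟨b, hb⟩, hX⟩ => by
    change minusNProj R n (X⟦k⟧)
    rw [minusNProj, shift_as]
    exact ⟨⟨b - k, fun i hi => hb (i + k) (by lia)⟩, fun i => hX (i + k)⟩⟩

instance : (minusNProj R n).IsTriangulated where
  toIsTriangulatedClosed₂ := by
    have : (minusNProj R n).IsTriangulatedClosed₃ := isTriangulatedClosed₃_of_cone _ (by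
      intro X Y f ⟨⟨b, hb⟩, hX⟩ ⟨⟨b', hb'⟩, hY⟩
      refine ⟨⟨max b b', fun i hi => ?_⟩, fun i => ?_⟩
      · exact (CochainComplex.mappingCone.isZero_X_iff f i).2
          ⟨hb _ (by lia), hb' _ (by lia)⟩
      · have := HomologicalComplex.HasHomotopyCofiber.hasBinaryBiproduct f i (i + 1) rfl
        exact (nProj R n).prop_of_iso
          (HomologicalComplex.homotopyCofiber.XIsoBiprod f i (i + 1) rfl).symm
          (nProj_biprod n (hX (i + 1)) (hY i)))
    exact .of_isTriangulatedClosed₃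

/-- The bounded homotopy category `K^b(R)`. -/
abbrev Kb := (bounded R).FullSubcategory

/-- The subcategory `K^b_n(R)` of `K^b(R)` of bounded `n`-exact complexes. -/
abbrev nExactKb : ObjectProperty (Kb R) := (nExact R n).inverseImage (bounded R).ι

/-- The bounded `n`-derived category: the Verdier quotient `K^b(R) / K^b_n(R)`, i.e. the
localization of `K^b(R)` at the morphisms whose cone lies in `K^b_n(R)`, with its
canonical triangulated structure. -/
abbrev Dbn := (nExactKb R n).trW.Localization

/-- The triangulated category `K^{-,nb}(𝒫_n)`. -/
abbrev Knb := (nExactLow R n ⊓ minusNProj R n).FullSubcategory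

end Triangulated

end NDerived

/-! Call a morphism of `K R` with `n`-exact cone an `n`-quasi-isomorphism. Both `K^b(R)` and
`K^{-,nb}(𝒫_n)` lie in the category of bounded above complexes that are `n`-exact in low degrees,
and the comparison takes place there.

Modules in `𝒫^{<n+1}` are finitely generated, hence form a set up to isomorphism, so every module
has a cover by an `n`-projective through which all maps from them factor. Iterated covers give each
bounded above complex an `n`-quasi-isomorphism from a complex of `n`-projectives
(`exists_resolution`). Bounded above complexes of `n`-projectives have no nonzero maps to `n`-exact
complexes (`leftOrthogonal_of_minusNProj`). Hence resolution is right adjoint to the inclusion of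
`K^{-,nb}(𝒫_n)` and inverts `n`-quasi-isomorphisms, so on `K^b(R)` it descends to the Verdier
quotient.

The way back is truncation. A complex that is `n`-exact in low degrees is `n`-quasi-isomorphic to
its truncation in degrees `≥ m` for `m` small, and maps from it to a fixed bounded complex factor
uniquely through that truncation (`exists_bounded_of_nExactLow`). This gives essential surjectivity.
Applied to the resolution of a bounded `X`, it gives a roof `X ← T → Y` for every map between
resolutions, whence fullness and faithfulness. -/

namespace NDerived

/-! ### Enough `n`-projective modules -/

section NProjectiveCovers

variable {R : Type u} [Ring R] (n : ℕ∞)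

lemma nProj_of_finProjRes {M : ModuleCat.{u} R} (h : finProjRes R n M) : nProj R n M :=
  fun _ hS => hS.2 M h

lemma finite_of_finProjRes {M : ModuleCat.{u} R} (h : finProjRes R n M) : Module.Finite R M := by
  obtain ⟨k, -, P, hP, -⟩ := h
  have := hP 0
  have hπ : Epi (P.π.f 0) := inferInstance
  let e : ((ChainComplex.single₀ (ModuleCat.{u} R)).obj M).X 0 ≅ M :=
    HomologicalComplex.singleObjXSelf (ComplexShape.down ℕ) 0 M
  have h2 : Epi (P.π.f 0 ≫ e.hom) := epi_comp _ _
  exact Module.Finite.of_surjective (P.π.f 0 ≫ e.hom).hom ((ModuleCat.epi_iff_surjective _).1 h2)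

lemma nProj_sigma {J : Type u} (M : J → ModuleCat.{u} R) (hM : ∀ j, nProj R n (M j)) :
    nProj R n (∐ M) := by
  rw [nProj_iff]
  intro S hS f
  choose g hg using fun j => (nProj_iff n _).1 (hM j) S hS (Sigma.ι M j ≫ f)
  exact ⟨Sigma.desc g, Sigma.hom_ext _ _ fun j => by simp [hg]⟩

/-- There are enough `n`-projective modules. -/
lemma exists_nProj_cover (Z : ModuleCat.{u} R) :
    ∃ (P : ModuleCat.{u} R) (π : P ⟶ Z), nProj R n P ∧
      ∀ M, finProjRes R n M → ∀ f : M ⟶ Z, ∃ g : M ⟶ P, g ≫ π = f := by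
  -- Up to isomorphism, finitely generated modules are quotients of some `Fin k → R`, so this index
  -- type is small. Requiring only `n`-projectivity still includes all of `𝒫^{<n+1}` and makes the
  -- coproduct `n`-projective.
  let I := {N : Σ k : ℕ, Submodule R (Fin k → R) //
    nProj R n (ModuleCat.of R ((Fin N.1 → R) ⧸ N.2))}
  let F : (Σ i : I, ModuleCat.of R ((Fin i.1.1 → R) ⧸ i.1.2) ⟶ Z) → ModuleCat.{u} R :=
    fun j => ModuleCat.of R ((Fin j.1.1.1 → R) ⧸ j.1.1.2)
  refine ⟨∐ F, Sigma.desc fun j => j.2, nProj_sigma n _ fun j => j.1.2, fun M hM f => ?_⟩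
  have := finite_of_finProjRes n hM
  obtain ⟨k, q, hq⟩ := Module.Finite.exists_fin' R M
  let e : ModuleCat.of R ((Fin k → R) ⧸ LinearMap.ker q) ≅ M :=
    (q.quotKerEquivOfSurjective hq).toModuleIso
  let i : I := ⟨⟨k, LinearMap.ker q⟩, (nProj R n).prop_of_iso e.symm (nProj_of_finProjRes n hM)⟩
  exact ⟨e.inv ≫ Sigma.ι F ⟨i, e.hom ≫ f⟩, by simp⟩

end NProjectiveCovers

/-! ### Resolutions by `n`-projective modules -/

section Resolution

variable {R : Type u} [Ring R] (n : ℕ∞)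

/-- One step of the construction of a resolution: the pullback of the cycles of the cone of a
partially defined morphism of complexes, covered by an `n`-projective module. -/
lemma exists_resolution_step {P Q A B : ModuleCat.{u} R} (d : P ⟶ Q) (f : P ⟶ B) (a : A ⟶ B) :
    ∃ (P' : ModuleCat.{u} R) (d' : P' ⟶ P) (f' : P' ⟶ A), nProj R n P' ∧ d' ≫ d = 0 ∧
      d' ≫ f = f' ≫ a ∧ ∀ M, finProjRes R n M → ∀ (p : M ⟶ P) (x : M ⟶ A), p ≫ d = 0 →
        p ≫ f = x ≫ a → ∃ y : M ⟶ P', y ≫ d' = p ∧ y ≫ f' = x := by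
  -- The kernel consists of the pairs `(p, x)` with `dp = 0` and `fp = ax`: up to sign, the cycles
  -- of the cone. Covering it makes these cycles boundaries after applying `Hom(M, -)`.
  let φ : P ⊞ A ⟶ Q ⊞ B := biprod.lift (biprod.fst ≫ d) (biprod.fst ≫ f - biprod.snd ≫ a)
  obtain ⟨P', π, hP', hπ⟩ := exists_nProj_cover n (kernel φ)
  have h₁ : kernel.ι φ ≫ biprod.fst ≫ d = 0 := by
    have h := kernel.condition φ =≫ biprod.fst
    rwa [Category.assoc, biprod.lift_fst, zero_comp] at h
  have h₂ : kernel.ι φ ≫ biprod.fst ≫ f = kernel.ι φ ≫ biprod.snd ≫ a := by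
    have h := kernel.condition φ =≫ biprod.snd
    rwa [Category.assoc, biprod.lift_snd, zero_comp, Preadditive.comp_sub, sub_eq_zero] at h
  refine ⟨P', π ≫ kernel.ι φ ≫ biprod.fst, π ≫ kernel.ι φ ≫ biprod.snd, hP', by simp [h₁],
    by simp [h₂], fun M hM p x hp hx => ?_⟩
  obtain ⟨y, hy⟩ := hπ M hM (kernel.lift φ (biprod.lift p x) (by
    apply biprod.hom_ext <;> simp [φ, hp, hx]))
  exact ⟨y, by simp [reassoc_of% hy], by simp [reassoc_of% hy]⟩

/-- The last term of a partially constructed resolution of a complex. -/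
structure ResolutionStage (X : CochainComplex (ModuleCat.{u} R) ℤ) (i : ℤ) where
  /-- the last term -/
  P : ModuleCat.{u} R
  /-- the next to last term -/
  Q : ModuleCat.{u} R
  /-- the differential -/
  d : P ⟶ Q
  /-- the augmentation -/
  f : P ⟶ X.X i

/-- Adding one more term to a partially constructed resolution. -/
noncomputable def ResolutionStage.next {X : CochainComplex (ModuleCat.{u} R) ℤ} {j : ℤ}
    (s : ResolutionStage X j) (i : ℤ) : ResolutionStage X i where
  P := (exists_resolution_step n s.d s.f (X.d i j)).choose
  Q := s.P
  d := (exists_resolution_step n s.d s.f (X.d i j)).choose_spec.choose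
  f := (exists_resolution_step n s.d s.f (X.d i j)).choose_spec.choose_spec.choose

lemma ResolutionStage.next_spec {X : CochainComplex (ModuleCat.{u} R) ℤ} {j : ℤ}
    (s : ResolutionStage X j) (i : ℤ) :
    nProj R n (s.next n i).P ∧ (s.next n i).d ≫ s.d = 0 ∧
      (s.next n i).d ≫ s.f = (s.next n i).f ≫ X.d i j ∧
      ∀ M, finProjRes R n M → ∀ (p : M ⟶ s.P) (x : M ⟶ X.X i), p ≫ s.d = 0 →
        p ≫ s.f = x ≫ X.d i j →
        ∃ y : M ⟶ (s.next n i).P, y ≫ (s.next n i).d = p ∧ y ≫ (s.next n i).f = x :=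
  (exists_resolution_step n s.d s.f (X.d i j)).choose_spec.choose_spec.choose_spec

variable (X : CochainComplex (ModuleCat.{u} R) ℤ) (c : ℤ)

/-- The stages in the construction of a resolution of a complex `X` vanishing in degrees `≥ c`. -/
noncomputable def resolutionStage : ∀ k : ℕ, ResolutionStage X (c - k)
  -- Stage `k` sits in degree `c - k`. Since `X` vanishes from degree `c` on, the construction can
  -- start with zero.
  | 0 => { P := 0, Q := 0, d := 0, f := 0 }
  | k + 1 => (resolutionStage k).next n (c - (k + 1 : ℕ))

/-- The terms of the resolution of `X`, as a chain complex. -/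
noncomputable def resolutionChain : ChainComplex (ModuleCat.{u} R) ℕ :=
  ChainComplex.of (fun k => (resolutionStage n X c k).P)
    (fun k => (resolutionStage n X c (k + 1)).d)
    (fun k => ((resolutionStage n X c (k + 1)).next_spec n _).2.1)

lemma resolutionChain_d (k : ℕ) :
    (resolutionChain n X c).d (k + 1) k = (resolutionStage n X c (k + 1)).d :=
  ChainComplex.of_d (fun k => (resolutionStage n X c k).P)
    (fun k => (resolutionStage n X c (k + 1)).d) k

lemma isZero_resolutionChain_zero : IsZero ((resolutionChain n X c).X 0) := isZero_zero _

lemma nProj_resolutionChain (k : ℕ) : nProj R n ((resolutionChain n X c).X k) := by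
  cases k with
  | zero => exact nProj_of_isZero n (isZero_resolutionChain_zero n X c)
  | succ k => exact ((resolutionStage n X c k).next_spec n _).1

/-- The augmentation of the chain complex `resolutionChain`. -/
noncomputable def resolutionChainπ (k : ℕ) (i : ℤ) (h : c - k = i) :
    (resolutionChain n X c).X k ⟶ X.X i :=
  (resolutionStage n X c k).f ≫ (X.XIsoOfEq h).hom

lemma resolutionChainπ_self (k : ℕ) :
    resolutionChainπ n X c k _ rfl = (resolutionStage n X c k).f := Category.comp_id _

lemma resolutionChain_comm (k l : ℕ) (hkl : l + 1 = k) (i j : ℤ) (hi : c - k = i)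
    (hj : c - l = j) :
    (resolutionChain n X c).d k l ≫ resolutionChainπ n X c l j hj =
      resolutionChainπ n X c k i hi ≫ X.d i j := by
  subst hkl hi hj
  rw [resolutionChain_d, resolutionChainπ_self, resolutionChainπ_self]
  exact ((resolutionStage n X c l).next_spec n _).2.2.1

lemma resolutionChain_lift (k l : ℕ) (hkl : l + 1 = k) (i j : ℤ) (hi : c - k = i)
    (hj : c - l = j) (M : ModuleCat.{u} R) (hM : finProjRes R n M)
    (p : M ⟶ (resolutionChain n X c).X l) (x : M ⟶ X.X i)
    (hp : ∀ m, p ≫ (resolutionChain n X c).d l m = 0)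
    (hx : p ≫ resolutionChainπ n X c l j hj = x ≫ X.d i j) :
    ∃ y : M ⟶ (resolutionChain n X c).X k,
      y ≫ (resolutionChain n X c).d k l = p ∧ y ≫ resolutionChainπ n X c k i hi = x := by
  subst hkl hi hj
  obtain ⟨y, hy, hy'⟩ := ((resolutionStage n X c l).next_spec n _).2.2.2 M hM p x (by
    cases l with
    | zero => exact comp_zero
    | succ l =>
      have h := hp l
      rwa [resolutionChain_d] at h) (by rwa [resolutionChainπ_self] at hx)
  refine ⟨y, ?_, ?_⟩
  · rw [resolutionChain_d]
    exact hy
  · rw [resolutionChainπ_self]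
    exact hy'

/-- A resolution of a complex `X` vanishing in degrees `≥ c` by `n`-projective modules. -/
noncomputable def resolution : CochainComplex (ModuleCat.{u} R) ℤ where
  X i := (resolutionChain n X c).X (c - i).toNat
  d i j := (resolutionChain n X c).d (c - i).toNat (c - j).toNat
  shape i j hij := by
    -- `toNat` collapses all degrees `≥ c` to index `0`, where the term is zero.
    by_cases h : (c - j).toNat = 0
    · exact IsZero.eq_of_tgt (by rw [h]; exact isZero_resolutionChain_zero n X c) _ _
    · refine HomologicalComplex.shape _ _ _ fun (h' : (c - j).toNat + 1 = (c - i).toNat) => hij ?_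
      change i + 1 = j
      lia

lemma nProj_resolution (i : ℤ) : nProj R n ((resolution n X c).X i) :=
  nProj_resolutionChain n X c _

lemma isZero_resolution (i : ℤ) (hi : c ≤ i) : IsZero ((resolution n X c).X i) := by
  change IsZero ((resolutionChain n X c).X (c - i).toNat)
  rw [show (c - i).toNat = 0 by lia]
  exact isZero_resolutionChain_zero n X c

/-- The components of the augmentation of the resolution of `X`. -/
noncomputable def resolutionπf (i : ℤ) : (resolution n X c).X i ⟶ X.X i :=
  -- The condition fails only for `i > c`, where the source is zero, so the default value is
  -- harmless.
  if h : c - (c - i).toNat = i then resolutionChainπ n X c _ i h else 0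

lemma resolutionπf_eq (i : ℤ) (h : c - (c - i).toNat = i) :
    resolutionπf n X c i = resolutionChainπ n X c _ i h := dif_pos h

/-- The augmentation of the resolution of `X`. -/
noncomputable def resolutionπ : resolution n X c ⟶ X where
  f i := resolutionπf n X c i
  comm' i j hij := by
    obtain rfl : i + 1 = j := hij
    by_cases h : i < c
    · rw [resolutionπf_eq n X c i (by lia), resolutionπf_eq n X c (i + 1) (by lia)]
      exact (resolutionChain_comm n X c _ _ (by lia) _ _ _ _).symm
    · exact (isZero_resolution n X c i (by lia)).eq_of_src _ _

lemma resolutionπ_lift (hX : ∀ i ≥ c, IsZero (X.X i)) (i j k : ℤ) (hij : i + 1 = j)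
    (hjk : j + 1 = k) (M : ModuleCat.{u} R) (hM : finProjRes R n M)
    (p : M ⟶ (resolution n X c).X j) (x : M ⟶ X.X i)
    (hp : p ≫ (resolution n X c).d j k = 0) (hx : p ≫ (resolutionπ n X c).f j = x ≫ X.d i j) :
    ∃ y : M ⟶ (resolution n X c).X i,
      y ≫ (resolution n X c).d i j = p ∧ y ≫ (resolutionπ n X c).f i = x := by
  by_cases h : i < c
  · have hi : (resolutionπ n X c).f i = resolutionChainπ n X c _ i (by lia) := resolutionπf_eq n X c i _
    have hj : (resolutionπ n X c).f j = resolutionChainπ n X c _ j (by lia) := resolutionπf_eq n X c j _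
    rw [hj] at hx
    rw [hi]
    refine resolutionChain_lift n X c _ _ (by lia) i j _ _ M hM p x (fun m => ?_) hx
    by_cases hm : m + 1 = (c - j).toNat
    · obtain rfl : m = (c - k).toNat := by lia
      exact hp
    · rw [HomologicalComplex.shape _ _ _ hm]
      exact comp_zero
  · exact ⟨0, (isZero_resolution n X c j (by lia)).eq_of_tgt _ _,
      (hX i (by lia)).eq_of_tgt _ _⟩

/-- The vanishing of `Hom(M, -)`-cohomology of a mapping cone, in terms of lifts. -/
lemma homExactAt_mappingCone {X Y : CochainComplex (ModuleCat.{u} R) ℤ} (φ : X ⟶ Y)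
    (M : ModuleCat.{u} R) (i j k l : ℤ) (hij : i + 1 = j) (hjk : j + 1 = k) (hkl : k + 1 = l)
    (h : ∀ (p : M ⟶ X.X k) (y : M ⟶ Y.X j), p ≫ X.d k l = 0 → p ≫ φ.f k = y ≫ Y.d j k →
      ∃ (q : M ⟶ X.X j) (z : M ⟶ Y.X i), q ≫ X.d j k = p ∧ q ≫ φ.f j + z ≫ Y.d i j = y) :
    HomExactAt M (CochainComplex.mappingCone φ) j := by
  rw [homExactAt_iff' M _ i j k hij hjk]
  intro f hf
  obtain ⟨p, y, rfl⟩ := CochainComplex.mappingCone.decomp_to φ f k hjk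
  have h₁ : p ≫ X.d k l = 0 := by
    simpa [CochainComplex.mappingCone.d_fst_v _ _ _ _ hjk hkl] using
      hf =≫ (CochainComplex.mappingCone.fst φ).1.v k l hkl
  have h₂ : p ≫ φ.f k + y ≫ Y.d j k = 0 := by
    simpa [CochainComplex.mappingCone.d_snd_v _ _ _ hjk] using
      hf =≫ (CochainComplex.mappingCone.snd φ).v k k (add_zero k)
  -- The cone differential is `(p, y) ↦ (-dp, φp + dy)`; this accounts for `-y` here and for the
  -- signs of `q` and `z` below.
  obtain ⟨q, z, hq, hz⟩ := h p (-y) h₁ (by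
    rw [Preadditive.neg_comp]
    exact eq_neg_of_add_eq_zero_left h₂)
  refine ⟨(-q) ≫ (CochainComplex.mappingCone.inl φ).v j i (by lia) +
    (-z) ≫ (CochainComplex.mappingCone.inr φ).f i, ?_⟩
  apply CochainComplex.mappingCone.ext_to φ j k hjk
  · simp [CochainComplex.mappingCone.d_fst_v _ _ _ _ hij hjk, hq]
  · have hz' : -(q ≫ φ.f j) + -(z ≫ Y.d i j) = y := by rw [← neg_add, hz, neg_neg]
    simpa [CochainComplex.mappingCone.d_snd_v _ _ _ hij] using hz'

lemma homExactAt_mappingCone_resolutionπ (hX : ∀ i ≥ c, IsZero (X.X i)) (M : ModuleCat.{u} R)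
    (hM : finProjRes R n M) (i : ℤ) :
    HomExactAt M (CochainComplex.mappingCone (resolutionπ n X c)) i :=
  homExactAt_mappingCone _ M (i - 1) i (i + 1) (i + 2) (by lia) rfl (by lia) fun p x hp hx => by
    obtain ⟨q, hq, hq'⟩ := resolutionπ_lift n X c hX i _ _ rfl (by lia) M hM p x hp hx
    exact ⟨q, 0, hq, by simp [hq']⟩

end Resolution

/-! ### Orthogonality of `n`-projective and `n`-exact complexes -/

section Orthogonality

open CochainComplex.HomComplex

variable {R : Type u} [Ring R] (n : ℕ∞)

/-- By exactness, the cokernel of the differential into degree `j - 1` is the module of cycles in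
degree `j`. A map from `P` to these cycles thus lifts along an `n`-exact sequence. -/
lemma homExactAt_of_nProj (X : CochainComplex (ModuleCat.{u} R) ℤ) (hX : ∀ i, NExactAt n X i)
    (P : ModuleCat.{u} R) (hP : nProj R n P) (j : ℤ) : HomExactAt P X j := by
  obtain ⟨i, hij⟩ : ∃ i, i + 1 = j := ⟨j - 1, by lia⟩
  obtain ⟨w, hS⟩ := hX i
  have h := fun k : ℤ => isZero_homology_of_comp_eq_zero X k (hX k).choose
  have e₁ : Mono (X.opcyclesToCycles i j) := by
    have := mono_fromOpcycles_of_isZero X i j hij (h i)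
    rw [← X.opcyclesToCycles_iCycles i j] at this
    exact mono_of_mono _ (X.iCycles j)
  have e₂ : Epi (X.opcyclesToCycles i j) := by
    have := epi_toCycles_of_isZero X i j hij (h j)
    rw [← X.pOpcycles_opcyclesToCycles i j] at this
    exact epi_of_epi (X.pOpcycles i) _
  have e : IsIso (X.opcyclesToCycles i j) := isIso_of_mono_of_epi _
  rw [homExactAt_iff' P X i j (j + 1) hij rfl]
  intro f hf
  obtain ⟨g, hg : g ≫ X.pOpcycles i = _⟩ := (nProj_iff n P).1 hP _ hS
    (X.liftCycles f (j + 1) (by simp) hf ≫ inv (X.opcyclesToCycles i j))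
  refine ⟨g, ?_⟩
  rw [← X.pOpcycles_opcyclesToCycles_iCycles i j, reassoc_of% hg, IsIso.inv_hom_id_assoc,
    X.liftCycles_i]

/-- Descending induction step for a null-homotopy. The defect in degree `m` is a cocycle because the
homotopy equation holds in degree `m + 1`, so exactness of `Hom(P.X m, N)` provides a correction,
which leaves higher degrees untouched. -/
lemma exists_homotopy_step {P N : CochainComplex (ModuleCat.{u} R) ℤ} (f : P ⟶ N) (m : ℤ)
    (hP : HomExactAt (P.X m) N m) (α : Cochain P N (-1))
    (hα : ∀ p > m, (δ (-1) 0 α).v p p (add_zero p) = f.f p) :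
    ∃ β : Cochain P N (-1), (∀ p q hpq, p > m → β.v p q hpq = α.v p q hpq) ∧
      ∀ p > m - 1, (δ (-1) 0 β).v p p (add_zero p) = f.f p := by
  let v := f.f m - α.v m (m - 1) (by lia) ≫ N.d (m - 1) m -
    P.d m (m + 1) ≫ α.v (m + 1) m (by lia)
  have hv : v ≫ N.d m (m + 1) = 0 := by
    have eq := hα (m + 1) (by lia)
    simp only [δ_v (-1) 0 (neg_add_cancel 1) α (m + 1) (m + 1) (add_zero _) m (m + 2)
      (by lia) (by lia), Int.negOnePow_zero, one_smul] at eq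
    simp [v, ← eq]
  obtain ⟨g, hg⟩ := hP v hv
  refine ⟨α + Cochain.single g (-1), fun p q hpq hp => ?_, fun p hp => ?_⟩
  · rw [Cochain.add_v, Cochain.single_v_eq_zero _ _ _ _ _ (by lia), add_zero]
  · by_cases hpm : p = m
    · subst hpm
      rw [δ_v (-1) 0 (neg_add_cancel 1) _ p p (by lia) (p - 1) (p + 1) (by lia) (by lia),
        Cochain.add_v, Cochain.add_v,
        Cochain.single_v_eq_zero _ _ (p + 1) _ _ (by lia)]
      simp [hg]
      simp only [v]
      abel
    · rw [δ_add, Cochain.add_v, hα p (by lia),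
        δ_v (-1) 0 (neg_add_cancel 1) _ p p (add_zero p) (p - 1) (p + 1) rfl rfl,
        Cochain.single_v_eq_zero _ _ _ _ _ (by lia), Cochain.single_v_eq_zero _ _ _ _ _ (by lia)]
      simp

/-- Morphisms from a bounded above complex `P` to a complex `N` that is `Hom(Pⁱ, -)`-exact
in degree `i` for all `i` are null-homotopic. -/
lemma nonempty_homotopy_zero {P N : CochainComplex (ModuleCat.{u} R) ℤ} (f : P ⟶ N) (b : ℤ)
    (hb : ∀ i > b, IsZero (P.X i)) (h : ∀ i, HomExactAt (P.X i) N i) :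
    Nonempty (Homotopy f 0) := by
  obtain ⟨s, hs₀, hs₁⟩ : ∃ s : ℕ → Cochain P N (-1),
      (∀ k : ℕ, ∀ p > b - k, (δ (-1) 0 (s k)).v p p (add_zero p) = f.f p) ∧
      ∀ (k : ℕ) (p q : ℤ) (hpq : p + -1 = q), p > b - k →
        (s (k + 1)).v p q hpq = (s k).v p q hpq := by
    have h₀ : ∀ p > b - (0 : ℕ), (δ (-1) 0 (0 : Cochain P N (-1))).v p p (add_zero p) = f.f p :=
      fun p hp => (hb p (by simpa using hp)).eq_of_src _ _
    have step (k : ℕ) (α : Cochain P N (-1))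
        (hα : ∀ p > b - k, (δ (-1) 0 α).v p p (add_zero p) = f.f p) :
        ∃ β : Cochain P N (-1), (∀ p > b - (k + 1 : ℕ),
          (δ (-1) 0 β).v p p (add_zero p) = f.f p) ∧
          ∀ p q hpq, p > b - k → β.v p q hpq = α.v p q hpq := by
      obtain ⟨β, hβ, hβ'⟩ := exists_homotopy_step f (b - k) (h _) α hα
      exact ⟨β, fun p hp => hβ' p (by push_cast at hp; omega), hβ⟩
    choose β hβ hβ' using step
    let s : ∀ k : ℕ, {α : Cochain P N (-1) //
        ∀ p > b - k, (δ (-1) 0 α).v p p (add_zero p) = f.f p} :=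
      fun k => Nat.rec ⟨0, h₀⟩ (fun k α => ⟨β k α α.2, hβ k α α.2⟩) k
    exact ⟨fun k => (s k).1, fun k => (s k).2, fun k => hβ' k _ (s k).2⟩
  have hs (k l : ℕ) (p q : ℤ) (hpq : p + -1 = q) (hp : p > b - k) :
      (s (k + l)).v p q hpq = (s k).v p q hpq := by
    induction l with
    | zero => rfl
    | succ l hl =>
      rw [← hl]
      exact hs₁ (k + l) p q hpq (by push_cast; omega)
  -- The component with source in degree `p` is stable from stage `k` on as soon as `p > b - k`; `b
  -- + 1 - p`, cut off at `0`, is the first such stage.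
  let α : Cochain P N (-1) := Cochain.mk fun p q hpq => (s (b + 1 - p).toNat).v p q hpq
  have hα (k : ℕ) (p q : ℤ) (hpq : p + -1 = q) (hp : p > b - k) :
      α.v p q hpq = (s k).v p q hpq := by
    obtain ⟨l, rfl⟩ : ∃ l, k = (b + 1 - p).toNat + l := ⟨k - (b + 1 - p).toNat, by omega⟩
    exact (hs _ l p q hpq (by omega)).symm
  refine ⟨(Cochain.equivHomotopy f 0).symm ⟨α, ?_⟩⟩
  rw [Cochain.ofHom_zero, add_zero]
  ext p
  let k := (b + 1 - p).toNat
  rw [Cochain.ofHom_v, ← hs₀ k p (by omega),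
    δ_v (-1) 0 (neg_add_cancel 1) _ p p (add_zero p) (p - 1) (p + 1) rfl (by omega),
    δ_v (-1) 0 (neg_add_cancel 1) _ p p (add_zero p) (p - 1) (p + 1) rfl (by omega),
    hα k p (p - 1) (by omega) (by omega), hα k (p + 1) p (by omega) (by omega)]

lemma leftOrthogonal_of_minusNProj (P : K R) (hP : minusNProj R n P) :
    (nExact R n).leftOrthogonal P := by
  intro N f hN
  obtain ⟨⟨b, hb⟩, hP⟩ := hP
  obtain ⟨g : P.as ⟶ N.as, rfl⟩ := (HomotopyCategory.quotient _ _).map_surjective f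
  obtain ⟨h⟩ := nonempty_homotopy_zero g b hb fun i => homExactAt_of_nProj n N.as hN _ (hP i) i
  exact (HomotopyCategory.eq_of_homotopy _ _ h).trans (Functor.map_zero _ _ _)

end Orthogonality

/-! ### Truncation to bounded complexes -/

section Truncation

open ComplexShape HomologicalComplex

variable {R : Type u} [Ring R] (n : ℕ∞) (X : CochainComplex (ModuleCat.{u} R) ℤ)

lemma epi_πTruncGE_f (m i : ℤ) : Epi ((X.πTruncGE m).f i) :=
  inferInstanceAs (Epi ((HomologicalComplex.πTruncGE X (embeddingUpIntGE m)).f i))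

lemma isIso_πTruncGE_f (m i : ℤ) (hi : m < i) : IsIso ((X.πTruncGE m).f i) := by
  obtain ⟨k, rfl⟩ := Int.le.dest hi.le
  exact ((embeddingUpIntGE m).isIso_liftExtend_f_iff _
    (X.restrictionToTruncGE'_hasLift _) (i := k) rfl).2
    (X.isIso_restrictionToTruncGE' _ _ (by rw [boundaryGE_embeddingUpIntGE_iff]; lia))

/-- In the edge degree the truncation map is the projection onto a cokernel, which is the
epimorphism in the definition of `NExactAt`. -/
lemma exists_πTruncGE_f_eq (m : ℤ) :
    ∃ e : X.opcycles m ≅ (X.truncGE m).X m, (X.πTruncGE m).f m = X.pOpcycles m ≫ e.hom := by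
  have h₀ : (embeddingUpIntGE m).f 0 = m := by simp
  have hb : (embeddingUpIntGE m).BoundaryGE 0 := by rw [boundaryGE_embeddingUpIntGE_iff]
  refine ⟨(HomologicalComplex.truncGEXIsoOpcycles X (embeddingUpIntGE m) h₀ hb).symm, ?_⟩
  refine ((embeddingUpIntGE m).liftExtend_f _ (X.restrictionToTruncGE'_hasLift _) h₀).trans ?_
  rw [X.restrictionToTruncGE'_f_eq_iso_hom_pOpcycles_iso_inv _ h₀ hb]
  simp [truncGEXIsoOpcycles]
  rfl

lemma isZero_truncGE_X (m i : ℤ) (hi : i < m) : IsZero ((X.truncGE m).X i) :=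
  (X.truncGE m).isZero_of_isStrictlyGE m i hi

/-- The truncation of a complex which is `n`-exact in low degrees is an `n`-quasi-isomorphism. -/
lemma nExact_mappingCone_πTruncGE (m : ℤ) (hX : ∀ i ≤ m, NExactAt n X i) :
    nExact R n ((HomotopyCategory.quotient _ _).obj
      (CochainComplex.mappingCone (X.πTruncGE m))) := by
  rw [nExact_iff]
  intro j M hM
  refine homExactAt_mappingCone _ M (j - 1) j (j + 1) (j + 2) (by lia) rfl (by lia)
    fun p y hp hy => ?_
  -- Maps from `M` lift through the truncation map in degree `m` by `n`-exactness there, and above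
  -- `m` because it is an isomorphism. Below `m` the truncation vanishes and exactness of `Hom(M,
  -- X)` suffices.
  by_cases hj : m ≤ j
  · obtain ⟨q, hq⟩ : ∃ q : M ⟶ X.X j, q ≫ (X.πTruncGE m).f j = y := by
      obtain rfl | hj := hj.eq_or_lt
      · obtain ⟨e, he⟩ := exists_πTruncGE_f_eq X m
        obtain ⟨w, hS, hw⟩ := hX m le_rfl
        obtain ⟨q, hq : q ≫ X.pOpcycles m = _⟩ :=
          (homShortExact_iff M _ hS).1 (hw M hM) (y ≫ e.inv)
        exact ⟨q, by rw [he, reassoc_of% hq, e.inv_hom_id, Category.comp_id]⟩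
      · have := isIso_πTruncGE_f X m j hj
        exact ⟨y ≫ inv ((X.πTruncGE m).f j), by simp⟩
    refine ⟨q, 0, ?_, by simp [hq]⟩
    have := isIso_πTruncGE_f X m (j + 1) (by lia)
    rw [← cancel_mono ((X.πTruncGE m).f (j + 1)), hy, Category.assoc,
      ← (X.πTruncGE m).comm, reassoc_of% hq]
  · obtain ⟨q, hq⟩ := (homExactAt_iff' M X j (j + 1) (j + 2) rfl (by lia)).1
      (homExactAt_of_nExactAt n X j (j + 1) rfl (hX _ (by lia)) (hX _ (by lia)) M hM) p hp
    exact ⟨q, 0, hq, (isZero_truncGE_X X m j (by lia)).eq_of_tgt _ _⟩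

/-- Morphisms in the homotopy category to a complex in degrees `> m` factor uniquely through the
truncation in degrees `≥ m`. -/
lemma bijective_πTruncGE_comp (m : ℤ) (B : CochainComplex (ModuleCat.{u} R) ℤ)
    (hB : ∀ i ≤ m, IsZero (B.X i)) :
    Function.Bijective fun g : (HomotopyCategory.quotient _ (up ℤ)).obj (X.truncGE m) ⟶
      (HomotopyCategory.quotient _ (up ℤ)).obj B =>
        (HomotopyCategory.quotient _ (up ℤ)).map (X.πTruncGE m) ≫ g := by
  constructor
  · intro g₁ g₂ hg
    obtain ⟨g₁, rfl⟩ := (HomotopyCategory.quotient _ _).map_surjective g₁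
    obtain ⟨g₂, rfl⟩ := (HomotopyCategory.quotient _ _).map_surjective g₂
    dsimp only at hg
    rw [← Functor.map_comp, ← Functor.map_comp] at hg
    let h := HomotopyCategory.homotopyOfEq _ _ hg
    -- Above degree `m` the homotopy is transported along an isomorphism. From degrees `≤ m` the
    -- relevant components land in degrees `< m`, where `B` is zero.
    let s (i j : ℤ) : (X.truncGE m).X i ⟶ B.X j := by
      classical
      exact if hi : m < i then
        haveI := isIso_πTruncGE_f X m i hi
        inv ((X.πTruncGE m).f i) ≫ h.hom i j else 0
    have hs (i j : ℤ) (hij : j + 1 = i) : (X.πTruncGE m).f i ≫ s i j = h.hom i j := by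
      by_cases hi : m < i
      · have := isIso_πTruncGE_f X m i hi
        simp [s, hi]
      · exact (hB j (by lia)).eq_of_tgt _ _
    refine HomotopyCategory.eq_of_homotopy _ _
      { hom := s
        zero := fun i j hij => ?_
        comm := fun i => ?_ }
    · by_cases hi : m < i
      · simp [s, hi, h.zero i j hij]
      · simp [s, hi]
    · have := epi_πTruncGE_f X m i
      have hi := h.comm i
      rw [dNext_eq _ (show (up ℤ).Rel i (i + 1) from rfl),
        prevD_eq _ (show (up ℤ).Rel (i - 1) i by simp)] at hi ⊢
      rw [← cancel_epi ((X.πTruncGE m).f i), ← comp_f, hi, ← hs i (i - 1) (by lia),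
        ← hs (i + 1) i rfl]
      simp
  · intro g
    obtain ⟨g, rfl⟩ := (HomotopyCategory.quotient _ _).map_surjective g
    -- `B` agrees with its own truncation, so truncating `g` gives the factorization.
    have : B.IsStrictlyGE m := (B.isStrictlyGE_iff m).2 fun i hi => hB i hi.le
    refine ⟨(HomotopyCategory.quotient _ _).map
      (CochainComplex.truncGEMap g m ≫ inv (B.πTruncGE m)), ?_⟩
    dsimp only
    rw [← Functor.map_comp, CochainComplex.πTruncGE_naturality_assoc, IsIso.hom_inv_id,
      Category.comp_id]

lemma bounded_truncGE (m b : ℤ) (hX : ∀ i > b, IsZero (X.X i)) :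
    bounded R ((HomotopyCategory.quotient _ _).obj (X.truncGE m)) := by
  have : X.IsStrictlyLE b := (X.isStrictlyLE_iff b).2 fun i hi => hX i hi
  exact ⟨⟨m, fun i hi => isZero_truncGE_X X m i hi⟩,
    ⟨b, fun i hi => (X.truncGE m).isZero_of_isStrictlyLE b i hi⟩⟩

/-- A bounded above complex `X` that is `n`-exact in low degrees admits an `n`-quasi-isomorphism
to a bounded complex, through which morphisms to complexes in degrees `≥ a` factor uniquely. -/
lemma exists_bounded_of_nExactLow (X : K R) (hX : nExactLow R n X)
    (b : ℤ) (hb : ∀ i > b, IsZero (X.as.X i)) (a : ℤ) :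
    ∃ (T : K R) (π : X ⟶ T), bounded R T ∧ (nExact R n).trW π ∧
      ∀ B : K R, (∀ i < a, IsZero (B.as.X i)) →
        Function.Bijective fun g : T ⟶ B => π ≫ g := by
  obtain ⟨X, rfl⟩ := HomotopyCategory.quotient_obj_surjective X
  obtain ⟨m', hm'⟩ := hX
  -- Low enough both for `n`-exactness up to `m` and for the targets to vanish in degrees `≤ m`.
  let m := min m' (a - 1)
  refine ⟨(HomotopyCategory.quotient _ _).obj (CochainComplex.truncGE X m),
    (HomotopyCategory.quotient _ _).map (CochainComplex.πTruncGE X m), bounded_truncGE X m b hb,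
    ObjectProperty.trW.mk _ (HomotopyCategory.mappingCone_triangleh_distinguished _)
      (nExact_mappingCone_πTruncGE n X m fun i hi => hm' i (by lia)), fun B hB => ?_⟩
  obtain ⟨B, rfl⟩ := HomotopyCategory.quotient_obj_surjective B
  exact bijective_πTruncGE_comp X m B fun i hi => hB i (by lia)

end Truncation

/-! ### Resolution as a right adjoint -/

section Equivalence

open ObjectProperty

variable (R : Type u) [Ring R] (n : ℕ∞)

/-- Bounded above complexes. -/
def boundedAbove : ObjectProperty (K R) :=
  fun X => ∃ b : ℤ, ∀ i > b, IsZero (X.as.X i)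

instance : (boundedAbove R).ContainsZero where
  exists_zero := ⟨(HomotopyCategory.quotient _ _).obj (0 : CochainComplex (ModuleCat.{u} R) ℤ),
    Functor.map_isZero _ (isZero_zero _),
    ⟨0, fun i _ => Functor.map_isZero (HomologicalComplex.eval _ _ i) (isZero_zero _)⟩⟩

instance : (boundedAbove R).IsStableUnderShift ℤ where
  isStableUnderShiftBy k := ⟨fun X ⟨b, hb⟩ => by
    change boundedAbove R (X⟦k⟧)
    rw [boundedAbove, shift_as]
    exact ⟨b - k, fun i hi => hb (i + k) (by lia)⟩⟩

instance : (boundedAbove R).IsTriangulated where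
  toIsTriangulatedClosed₂ := by
    have : (boundedAbove R).IsTriangulatedClosed₃ := isTriangulatedClosed₃_of_cone _ (by
      intro X Y f ⟨b, hb⟩ ⟨b', hb'⟩
      exact ⟨max b b', fun i hi => (CochainComplex.mappingCone.isZero_X_iff f i).2
          ⟨hb _ (by lia), hb' _ (by lia)⟩⟩)
    exact .of_isTriangulatedClosed₃

/-- Bounded above complexes which are `n`-exact in low degrees. -/
abbrev minusNExactLow : ObjectProperty (K R) := nExactLow R n ⊓ boundedAbove R

lemma bounded_le : bounded R ≤ minusNExactLow R n := fun X ⟨⟨a, ha⟩, hb⟩ => by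
  refine ⟨(nExactLow_iff n X).2 ⟨a - 1, fun i hi P _ f _ => ⟨0, ?_⟩⟩, hb⟩
  exact (ha i (by lia)).eq_of_tgt _ _

lemma knb_le : nExactLow R n ⊓ minusNProj R n ≤ minusNExactLow R n :=
  fun _ hX => ⟨hX.1, hX.2.1⟩

/-- The inclusion of `K^b(R)`. -/
abbrev inclKb : Kb R ⥤ (minusNExactLow R n).FullSubcategory :=
  (minusNExactLow R n).lift (bounded R).ι fun X => bounded_le R n _ X.2

/-- The inclusion of `K^{-,nb}(𝒫_n)`. -/
abbrev inclKnb : Knb R n ⥤ (minusNExactLow R n).FullSubcategory :=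
  (minusNExactLow R n).lift (nExactLow R n ⊓ minusNProj R n).ι fun X => knb_le R n _ X.2

variable {R}

lemma exists_resolution (X : K R) (hX : minusNExactLow R n X) :
    ∃ (P : K R) (_ : (nExactLow R n ⊓ minusNProj R n) P) (f : P ⟶ X), (nExact R n).trW f := by
  obtain ⟨X, rfl⟩ := HomotopyCategory.quotient_obj_surjective X
  obtain ⟨hX, b, hb⟩ := hX
  have hT := HomotopyCategory.mappingCone_triangleh_distinguished (resolutionπ n X (b + 1))
  have hN : nExact R n ((HomotopyCategory.quotient _ _).obj
      (CochainComplex.mappingCone (resolutionπ n X (b + 1)))) :=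
    (nExact_iff n _).2 fun i M hM =>
      homExactAt_mappingCone_resolutionπ n X (b + 1) (fun i hi => hb i (by lia)) M hM i
  refine ⟨_, ⟨?_, ⟨b, fun i hi => isZero_resolution n X (b + 1) i (by lia)⟩,
    fun i => nProj_resolution n X (b + 1) i⟩, _, trW.mk _ hT hN⟩
  -- Low-degree `n`-exactness passes from `X` and the `n`-exact cone to the resolution.
  exact (nExactLow R n).ext_of_isTriangulatedClosed₁ _ hT hX ⟨0, fun i _ => hN i⟩

/-- Left orthogonality to the cones means that `Hom(P, -)` cannot distinguish the two ends of an
`n`-quasi-isomorphism. -/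
lemma bijective_comp_of_trW {P X Y : K R} (hP : minusNProj R n P) (f : X ⟶ Y)
    (hf : (nExact R n).trW f) : Function.Bijective fun g : P ⟶ X => g ≫ f := by
  have h := leftOrthogonal_of_minusNProj n P hP
  rw [← isColocal_trW] at h
  exact h f hf

/-- The resolution of a complex by `n`-projective modules. -/
noncomputable def resObj (X : (minusNExactLow R n).FullSubcategory) : Knb R n :=
  ⟨(exists_resolution n X.1 X.2).choose, (exists_resolution n X.1 X.2).choose_spec.choose⟩

/-- The augmentation of `resObj`. -/
noncomputable def resπ (X : (minusNExactLow R n).FullSubcategory) :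
    (inclKnb R n).obj (resObj n X) ⟶ X :=
  homMk (exists_resolution n X.1 X.2).choose_spec.choose_spec.choose

lemma trW_resπ (X : (minusNExactLow R n).FullSubcategory) : (nExact R n).trW (resπ n X).hom :=
  (exists_resolution n X.1 X.2).choose_spec.choose_spec.choose_spec

lemma bijective_map_comp (P : Knb R n) {X Y : (minusNExactLow R n).FullSubcategory} (f : X ⟶ Y)
    (hf : (nExact R n).trW f.hom) :
    Function.Bijective fun g : (inclKnb R n).obj P ⟶ X => g ≫ f := by
  have h := bijective_comp_of_trW n P.2.2 f.hom hf
  refine ⟨fun g₁ g₂ hg => ?_, fun g => ?_⟩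
  · ext
    exact h.1 (congrArg (·.hom) hg)
  · obtain ⟨g', hg'⟩ := h.2 g.hom
    exact ⟨homMk g', by ext; exact hg'⟩

/-- The universal property of `resObj`. -/
noncomputable def resHomEquiv (P : Knb R n) (X : (minusNExactLow R n).FullSubcategory) :
    ((inclKnb R n).obj P ⟶ X) ≃ (P ⟶ resObj n X) :=
  (Equiv.ofBijective (fun g : P ⟶ resObj n X => (inclKnb R n).map g ≫ resπ n X)
    ((bijective_map_comp n P (resπ n X) (trW_resπ n X)).comp
      ⟨(inclKnb R n).map_injective, (inclKnb R n).map_surjective⟩)).symm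

lemma resHomEquiv_symm_apply (P : Knb R n) (X : (minusNExactLow R n).FullSubcategory)
    (g : P ⟶ resObj n X) :
    (resHomEquiv n P X).symm g = (inclKnb R n).map g ≫ resπ n X := rfl

lemma resHomEquiv_naturality (P' P : Knb R n) (X : (minusNExactLow R n).FullSubcategory)
    (f : P' ⟶ P) (g : (inclKnb R n).obj P ⟶ X) :
    resHomEquiv n P' X ((inclKnb R n).map f ≫ g) = f ≫ resHomEquiv n P X g := by
  rw [← Equiv.eq_symm_apply, resHomEquiv_symm_apply, Functor.map_comp, Category.assoc,
    ← resHomEquiv_symm_apply, Equiv.symm_apply_apply]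

variable (R)

/-- The functor sending a complex to its resolution by `n`-projective modules. -/
noncomputable def resFunctor : (minusNExactLow R n).FullSubcategory ⥤ Knb R n :=
  Adjunction.rightAdjointOfEquiv (F := inclKnb R n) (resHomEquiv n) (resHomEquiv_naturality n)

/-- The resolution functor is right adjoint to the inclusion. -/
noncomputable def resAdj : inclKnb R n ⊣ resFunctor R n :=
  Adjunction.adjunctionOfEquivRight (resHomEquiv n) (resHomEquiv_naturality n)

noncomputable instance : (resFunctor R n).CommShift ℤ := (resAdj R n).rightAdjointCommShift ℤ

instance : (resAdj R n).CommShift ℤ := (resAdj R n).commShift_of_leftAdjoint ℤ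

instance : (resFunctor R n).IsTriangulated := (resAdj R n).isTriangulated_rightAdjoint

variable {R}

lemma resAdj_counit_app (X : (minusNExactLow R n).FullSubcategory) :
    (resAdj R n).counit.app X = resπ n X := by
  simp [resAdj, resHomEquiv_symm_apply]
  exact Category.id_comp _

end Equivalence

/-! ### The comparison functor is an equivalence -/

section Comparison

open ObjectProperty

variable (R : Type u) [Ring R] (n : ℕ∞)

variable {R} in
-- By Yoneda and the adjunction, this is bijectivity of composition with `f` on maps from complexes
-- in `K^{-,nb}(𝒫_n)`.
lemma isIso_resFunctor_map {X Y : (minusNExactLow R n).FullSubcategory} (f : X ⟶ Y)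
    (hf : (nExact R n).trW f.hom) : IsIso ((resFunctor R n).map f) := by
  refine isIso_of_yoneda_map_bijective _ fun P => ?_
  have h := (((resAdj R n).homEquiv P Y).bijective.comp (bijective_map_comp n P f hf)).comp
    ((resAdj R n).homEquiv P X).symm.bijective
  convert h using 1
  funext g
  change g ≫ (resFunctor R n).map f =
    (resAdj R n).homEquiv P Y (((resAdj R n).homEquiv P X).symm g ≫ f)
  rw [Adjunction.homEquiv_naturality_right, Equiv.apply_symm_apply]

/-- The resolution functor on the bounded homotopy category. -/
noncomputable abbrev resKb : Kb R ⥤ Knb R n := inclKb R n ⋙ resFunctor R n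

lemma trW_hom_of_trW {X Y : Kb R} (f : X ⟶ Y) (hf : (nExactKb R n).trW f) :
    (nExact R n).trW f.hom :=
  trW_monotone (fun _ h => h.2) _ ((trW_inverseImage_ι_iff _ _ f).1 hf)

lemma trW_of_trW_hom {X Y : Kb R} (f : X ⟶ Y) (hf : (nExact R n).trW f.hom) :
    (nExactKb R n).trW f :=
  ((nExact R n).inverseImage_trW_iff (bounded R).ι f).2 hf

lemma resKb_inverts : (nExactKb R n).trW.IsInvertedBy (resKb R n) := fun _ _ f hf =>
  isIso_resFunctor_map n _ (trW_hom_of_trW R n f hf)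

/-- The functor from the bounded `n`-derived category induced by the resolution functor. -/
noncomputable def comparison : Dbn R n ⥤ Knb R n :=
  Localization.lift (resKb R n) (resKb_inverts R n) (nExactKb R n).trW.Q

noncomputable instance : Localization.Lifting (nExactKb R n).trW.Q (nExactKb R n).trW
    (resKb R n) (comparison R n) :=
  inferInstanceAs (Localization.Lifting _ _ _ (Localization.lift _ _ _))

noncomputable instance : (comparison R n).CommShift ℤ :=
  Functor.commShiftOfLocalization (nExactKb R n).trW.Q (nExactKb R n).trW ℤ (resKb R n) _

instance : (comparison R n).IsTriangulated := by
  -- Every morphism of the quotient is isomorphic to the image of one in `K^b(R)`, so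
  -- triangulatedness may be tested after composing with `Q`.
  have : (nExactKb R n).trW.Q.mapArrow.EssSurj :=
    Localization.essSurj_mapArrow _ (nExactKb R n).trW
  have := NatTrans.commShift_iso_hom_of_localization (nExactKb R n).trW.Q (nExactKb R n).trW ℤ
    (resKb R n) (comparison R n)
  exact Functor.isTriangulated_of_precomp_iso
    (Localization.Lifting.iso (nExactKb R n).trW.Q (nExactKb R n).trW (resKb R n)
      (comparison R n))

/-- The isomorphism between the composition of the localization functor with `comparison` and the
resolution functor. -/
noncomputable def QCompComparisonIso :
    (nExactKb R n).trW.Q ⋙ comparison R n ≅ resKb R n :=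
  Localization.Lifting.iso _ (nExactKb R n).trW _ _

variable {R}

lemma exists_bounded (X : (minusNExactLow R n).FullSubcategory) (a : ℤ) :
    ∃ (T : Kb R) (π : X ⟶ (inclKb R n).obj T), (nExact R n).trW π.hom ∧
      ∀ B : Kb R, (∀ i < a, IsZero (B.1.as.X i)) →
        Function.Bijective fun g : T ⟶ B => π ≫ (inclKb R n).map g := by
  obtain ⟨hX, b, hb⟩ := X.2
  obtain ⟨T, π, hT, hπ, h⟩ := exists_bounded_of_nExactLow n X.1 hX b hb a
  refine ⟨⟨T, hT⟩, homMk π, hπ, fun B hB => ⟨fun g₁ g₂ hg => ?_, fun g => ?_⟩⟩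
  · ext
    exact (h B.1 hB).1 (congrArg (·.hom) hg)
  · obtain ⟨g', hg'⟩ := (h B.1 hB).2 g.hom
    exact ⟨homMk g', by ext; exact hg'⟩

/-- By the octahedral axiom the cones of `f`, `f ≫ g` and `g` form a distinguished triangle. -/
lemma trW_of_precomp {X Y Z : K R} (f : X ⟶ Y) (g : Y ⟶ Z) (hf : (nExact R n).trW f)
    (hfg : (nExact R n).trW (f ≫ g)) : (nExact R n).trW g := by
  obtain ⟨A, _, _, hA, hA'⟩ := hf
  obtain ⟨B, _, _, hB, hB'⟩ := hfg
  obtain ⟨C, _, _, hC⟩ := Pretriangulated.distinguished_cocone_triangle g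
  have hT := (Triangulated.someOctahedron rfl hA hC hB).mem
  have hC' := (nExact R n).ext_of_isTriangulatedClosed₃ _ hT hA' hB'
  exact trW.mk _ hC hC'

/-- The `n`-quasi-isomorphisms of bounded complexes obtained by truncating resolutions. -/
lemma exists_bounded_roof (X Y : Kb R) :
    ∃ (T : Kb R) (π : (inclKnb R n).obj ((resKb R n).obj X) ⟶ (inclKb R n).obj T) (s : T ⟶ X),
      (nExactKb R n).trW s ∧
      π ≫ (inclKb R n).map s = (resAdj R n).counit.app ((inclKb R n).obj X) ∧
      Function.Bijective fun g : T ⟶ Y => π ≫ (inclKb R n).map g := by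
  obtain ⟨⟨a, ha⟩, -⟩ := X.2
  obtain ⟨⟨a', ha'⟩, -⟩ := Y.2
  -- The bound lies below both `X` and `Y`: the augmentation to `X` must factor through `T`, and so
  -- must all maps to `Y`.
  obtain ⟨T, π, hπ, h⟩ := exists_bounded n ((inclKnb R n).obj ((resKb R n).obj X)) (min a a')
  obtain ⟨s, hs⟩ := (h X fun i hi => ha i (by lia)).2
    ((resAdj R n).counit.app ((inclKb R n).obj X))
  refine ⟨T, π, s, trW_of_trW_hom R n s ?_, hs, h Y fun i hi => ha' i (by lia)⟩
  have h₁ : (nExact R n).trW (π.hom ≫ s.hom) := by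
    have : (nExact R n).trW ((resAdj R n).counit.app ((inclKb R n).obj X)).hom := by
      rw [resAdj_counit_app]
      exact trW_resπ n _
    rwa [← hs] at this
  exact trW_of_precomp n π.hom s.hom hπ h₁

/-- A map `φ'` between the resolutions, followed by the augmentation of `Y`, factors through `T` as
some `t : T ⟶ Y`; the fraction `s⁻¹ t` is the required preimage. -/
instance : (comparison R n).Full := by
  have : (nExactKb R n).trW.Q.EssSurj := Localization.essSurj _ (nExactKb R n).trW
  let e := QCompComparisonIso R n
  refine Functor.full_of_comp_essSurj _ (nExactKb R n).trW.Q fun X Y φ => ?_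
  obtain ⟨T, π, s, hs, hπ, h⟩ := exists_bounded_roof n X Y
  let φ' : (resKb R n).obj X ⟶ (resKb R n).obj Y := e.inv.app X ≫ φ ≫ e.hom.app Y
  obtain ⟨t, ht⟩ := h.2 ((inclKnb R n).map φ' ≫ (resAdj R n).counit.app ((inclKb R n).obj Y))
  have := Localization.inverts (nExactKb R n).trW.Q _ s hs
  -- Up to the isomorphism induced by `s`, the map `π` is the augmentation of `T`. This can be
  -- checked after composing with `s`, which is injective on maps from `n`-projective complexes.
  have hc : (resAdj R n).counit.app ((inclKb R n).obj T) =
      (inclKnb R n).map ((resKb R n).map s) ≫ π := by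
    apply (bijective_map_comp n _ ((inclKb R n).map s) (trW_hom_of_trW R n s hs)).1
    dsimp only
    rw [Category.assoc, hπ]
    exact ((resAdj R n).counit.naturality _).symm
  have hst : (resKb R n).map t = (resKb R n).map s ≫ φ' := by
    apply ((resAdj R n).homEquiv _ _).symm.injective
    simp only [Adjunction.homEquiv_counit]
    have h₁ := (resAdj R n).counit.naturality ((inclKb R n).map t)
    refine h₁.trans ?_
    rw [hc]
    dsimp only [Functor.id_map] at ht ⊢
    rw [Functor.map_comp, Category.assoc, Category.assoc, ht]
  refine ⟨inv ((nExactKb R n).trW.Q.map s) ≫ (nExactKb R n).trW.Q.map t, ?_⟩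
  rw [Functor.map_comp, Functor.map_inv, IsIso.inv_comp_eq, ← cancel_mono (e.hom.app Y)]
  have h₁ := e.hom.naturality t
  have h₂ := e.hom.naturality s
  dsimp only [Functor.comp_map] at h₁ h₂
  have h₃ : φ ≫ e.hom.app Y = e.hom.app X ≫ φ' := (e.hom_inv_id_app_assoc X _).symm
  refine h₁.trans ?_
  rw [Category.assoc]
  refine Eq.trans ?_ (congrArg (_ ≫ ·) h₃.symm)
  rw [← Category.assoc]
  refine Eq.trans ?_ (congrArg (· ≫ φ') h₂.symm)
  rw [Category.assoc]
  exact congrArg (_ ≫ ·) hst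

/-- By calculus of fractions only morphisms `Q(f)` need testing. If `f` dies on resolutions, then `π
≫ s ≫ f` is zero, hence so is `s ≫ f`, and `Q(s)` is invertible. -/
instance : (comparison R n).Faithful := by
  let e := QCompComparisonIso R n
  have : (comparison R n).Additive := Functor.IsTriangulated.instAdditive _
  refine Functor.faithful_of_comp_cancel_zero_of_hasLeftCalculusOfFractions
    (nExactKb R n).trW.Q (nExactKb R n).trW _ fun X Y f hf => ?_
  obtain ⟨T, π, s, hs, hπ, h⟩ := exists_bounded_roof n X Y
  have := Localization.inverts (nExactKb R n).trW.Q _ s hs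
  have hf' : (resKb R n).map f = 0 := by
    rw [← cancel_epi (e.hom.app X)]
    refine (e.hom.naturality f).symm.trans ?_
    change (comparison R n).map ((nExactKb R n).trW.Q.map f) ≫ _ = _
    rw [hf, zero_comp, comp_zero]
  have hsf : s ≫ f = 0 := by
    apply h.1
    dsimp only
    rw [Functor.map_comp, reassoc_of% hπ, Functor.map_zero, comp_zero]
    refine ((resAdj R n).counit.naturality ((inclKb R n).map f)).symm.trans ?_
    refine (congrArg (fun g => (inclKnb R n).map g ≫ _) hf').trans ?_
    simp
  rw [← cancel_epi ((nExactKb R n).trW.Q.map s), ← Functor.map_comp, hsf]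
  simp

instance : (comparison R n).EssSurj where
  mem_essImage Y := by
    -- The bound `0` is arbitrary, as only the `n`-quasi-isomorphism to a bounded complex matters.
    -- The unit at `Y` is invertible because the inclusion is fully faithful.
    obtain ⟨T, π, hπ, -⟩ := exists_bounded n ((inclKnb R n).obj Y) 0
    have := isIso_resFunctor_map n π hπ
    exact ⟨(nExactKb R n).trW.Q.obj T, ⟨(QCompComparisonIso R n).app T ≪≫
      (asIso ((resFunctor R n).map π)).symm ≪≫ (asIso ((resAdj R n).unit.app Y)).symm⟩⟩

end Comparison

end NDerived

theorem theorem5p10 (R : Type u) [Ring R] (n : ℕ∞) :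
    ∃ (e : NDerived.Dbn R n ≌ NDerived.Knb R n) (_ : e.functor.CommShift ℤ),
      e.functor.IsTriangulated := by
  have : (NDerived.comparison R n).IsEquivalence := { }
  exact ⟨(NDerived.comparison R n).asEquivalence,
    (inferInstance : (NDerived.comparison R n).CommShift ℤ),
    (inferInstance : (NDerived.comparison R n).IsTriangulated)⟩
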